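/- Let $\mathbb K\in\{\mathbb R,\mathbb C\}$ and $m,n\in\mathbb N_0$. Let $\mathcal S_n=\mathcal S(\mathbb R^n,\mathbb K)$ be the Schwartz space and $\mathcal S_n'$ its topological dual, the space of tempered distributions. Let $\mathcal O_M^{(m)}$ be the ring (under pointwise operations) of all smooth functions $f:\mathbb R^m\to\mathbb K$ such that $f\varphi\in\mathcal S_m$ for every $\varphi\in\mathcal S_m$; thus $f$ is invertible in $\mathcal O_M^{(m)}$ if and only if $f$ vanishes nowhere and $1/f\in\mathcal O_M^{(m)}$. An $^{\mathcal S}$family is a family $v=(v_p)_{p\in\mathbb R^m}$ in $\mathcal S_n'$ such that, for every $\varphi\in\mathcal S_n$, the function $\widehat v(\varphi):p\mapsto v_p(\varphi)$ belongs to $\mathcal S_m$. For $a\in\mathcal S_m'$ the superposition $\int_{\mathbb R^m}av$ is the tempered distribution $\varphi\mapsto a(\widehat v(\varphi))$. The family $v$ is $^{\mathcal S}$linearly independent if $\int_{\mathbb R^m}av=0$ implies $a=0$; it is an $^{\mathcal S}$basis of a subspace $V\subseteq\mathcal S_n'$ if it is $^{\mathcal S}$linearly independent and $V=\{\int_{\mathbb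 R^m}av : a\in\mathcal S_m'\}$. For $f\in\mathcal O_M^{(m)}$ the product $fv$ is the $^{\mathcal S}$family $(f(p)v_p)_{p\in\mathbb R^m}$. **Theorem.** Let $e=(e_p)_{p\in\mathbb R^m}$ be an $^{\mathcal S}$basis of the space $\mathcal S_n'$ and let $f\in\mathcal O_M^{(m)}$. Then the product $fe$ is an $^{\mathcal S}$basis of $\mathcal S_n'$ if and only if $f$ is an invertible element of the ring $\mathcal O_M^{(m)}$. -/

import Mathlib

open scoped SchwartzMap ContDiff

/-- The space `ℝⁿ`. -/
abbrev Rn (n : ℕ) := EuclideanSpace ℝ (Fin n)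

/-- The Schwartz space `𝓢ₙ` of rapidly decreasing test functions `ℝⁿ → 𝕜`. -/
abbrev TestFn (𝕜 : Type*) [RCLike 𝕜] (n : ℕ) := 𝓢(Rn n, 𝕜)

/-- The space `𝓢'ₙ` of tempered distributions on `ℝⁿ`: the continuous `𝕜`-linear functionals
on `𝓢ₙ`. -/
abbrev TempDist (𝕜 : Type*) [RCLike 𝕜] (n : ℕ) := TestFn 𝕜 n →L[𝕜] 𝕜

/-- The ring `𝓞_M⁽ᵐ⁾` of slowly increasing smooth functions, as a subalgebra of the algebra of
all functions `ℝᵐ → 𝕜` with pointwise operations: smooth functions whose product with every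
test function is again a test function. -/
def OM (𝕜 : Type*) [RCLike 𝕜] (m : ℕ) : Subalgebra 𝕜 (Rn m → 𝕜) where
  carrier := {f | ContDiff ℝ ∞ f ∧ ∀ φ : TestFn 𝕜 m, ∃ ψ : TestFn 𝕜 m, ∀ x, ψ x = f x * φ x}
  mul_mem' := by
    rintro f g ⟨hf, hf'⟩ ⟨hg, hg'⟩
    refine ⟨hf.mul hg, fun φ => ?_⟩
    obtain ⟨ψ, hψ⟩ := hg' φ
    obtain ⟨χ, hχ⟩ := hf' ψ
    exact ⟨χ, fun x => by rw [hχ, hψ, Pi.mul_apply, mul_assoc]⟩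
  add_mem' := by
    rintro f g ⟨hf, hf'⟩ ⟨hg, hg'⟩
    refine ⟨hf.add hg, fun φ => ?_⟩
    obtain ⟨ψ, hψ⟩ := hf' φ
    obtain ⟨χ, hχ⟩ := hg' φ
    exact ⟨ψ + χ, fun x => by rw [add_apply, hψ, hχ, Pi.add_apply, add_mul]⟩
  algebraMap_mem' := fun c =>
    ⟨contDiff_const, fun φ => ⟨c • φ, fun x => by simp [Pi.algebraMap_apply]⟩⟩

/-- An `𝓢`-family `v = (v_p)` of tempered distributions on `ℝⁿ`, indexed by `p ∈ ℝᵐ`: for every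
test function `φ` on `ℝⁿ` the function `p ↦ v_p(φ)` is a test function on `ℝᵐ`. -/
structure SFamily (𝕜 : Type*) [RCLike 𝕜] (m n : ℕ) where
  /-- The members of the family. -/
  dist : Rn m → TempDist 𝕜 n
  schwartz' : ∀ φ : TestFn 𝕜 n, ∃ ψ : TestFn 𝕜 m, ∀ p, ψ p = dist p φ

namespace SFamily

/-- The operator `v̂ : 𝓢ₙ → 𝓢ₘ` associated with an `𝓢`-family, `v̂(φ)(p) = v_p(φ)`. -/
noncomputable def hat {𝕜 : Type*} [RCLike 𝕜] {m n : ℕ} (v : SFamily 𝕜 m n) :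
    TestFn 𝕜 n →ₗ[𝕜] TestFn 𝕜 m where
  toFun φ := (v.schwartz' φ).choose
  map_add' φ χ := by
    ext p
    rw [add_apply, (v.schwartz' (φ + χ)).choose_spec, (v.schwartz' φ).choose_spec,
      (v.schwartz' χ).choose_spec, map_add]
  map_smul' c φ := by
    ext p
    rw [RingHom.id_apply, smul_apply, (v.schwartz' (c • φ)).choose_spec,
      (v.schwartz' φ).choose_spec, map_smul]

theorem hat_apply {𝕜 : Type*} [RCLike 𝕜] {m n : ℕ} (v : SFamily 𝕜 m n) (φ : TestFn 𝕜 n)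
    (p : Rn m) : v.hat φ p = v.dist p φ :=
  (v.schwartz' φ).choose_spec p

/-- The superposition `∫ a v` of an `𝓢`-family `v` with coefficient distribution `a ∈ 𝓢'ₘ`: the
functional `φ ↦ a(v̂(φ))` on `𝓢ₙ`. The functional is automatically continuous, because the
operator `v̂` is (Banach–Steinhaus); the definitions below do not need to carry this fact, since
they compare superpositions only with elements of `𝓢'ₙ`. -/
noncomputable def superposition {𝕜 : Type*} [RCLike 𝕜] {m n : ℕ} (v : SFamily 𝕜 m n) :
    TempDist 𝕜 m →ₗ[𝕜] (TestFn 𝕜 n →ₗ[𝕜] 𝕜) where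
  toFun a := (a : TestFn 𝕜 m →ₗ[𝕜] 𝕜) ∘ₗ v.hat
  map_add' _ _ := rfl
  map_smul' _ _ := rfl

/-- The `𝓢`-linear hull of `v`: the subspace of all tempered distributions `u` of the form
`u = ∫ a v` for some coefficient distribution `a ∈ 𝓢'ₘ`. -/
noncomputable def span {𝕜 : Type*} [RCLike 𝕜] {m n : ℕ} (v : SFamily 𝕜 m n) :
    Submodule 𝕜 (TempDist 𝕜 n) :=
  (LinearMap.range v.superposition).comap (ContinuousLinearMap.coeLM 𝕜)

/-- `𝓢`-linear independence: `∫ a v = 0` only for `a = 0`. -/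
def LinIndep {𝕜 : Type*} [RCLike 𝕜] {m n : ℕ} (v : SFamily 𝕜 m n) : Prop :=
  ∀ a : TempDist 𝕜 m, v.superposition a = 0 → a = 0

/-- `v` is an `𝓢`-basis of the subspace `V` of `𝓢'ₙ`: it is `𝓢`-linearly independent and its
`𝓢`-linear hull is `V`. -/
def IsBasis {𝕜 : Type*} [RCLike 𝕜] {m n : ℕ} (v : SFamily 𝕜 m n)
    (V : Submodule 𝕜 (TempDist 𝕜 n)) : Prop :=
  v.LinIndep ∧ v.span = V

/-- The product `f v = (f(p) v_p)_p` of an `𝓢`-family by a function `f` of class `𝓞_M`. -/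
noncomputable instance {𝕜 : Type*} [RCLike 𝕜] {m n : ℕ} : SMul (OM 𝕜 m) (SFamily 𝕜 m n) where
  smul f v :=
    { dist := fun p => (f : Rn m → 𝕜) p • v.dist p
      schwartz' := fun φ => by
        obtain ⟨χ, hχ⟩ := f.2.2 (v.hat φ)
        exact ⟨χ, fun p => by
          rw [hχ, hat_apply, smul_apply, smul_eq_mul]⟩ }

end SFamily

/-!
The operator of the product `f e` is `M_f ∘ ê`, where `M_f` is multiplication by `f` on `𝓢ₘ`, so
superposition with `f e` is superposition with `e` after multiplying the coefficients by `f`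
(`SFamily.superposition_smul`). Since `e` is a basis, the theorem says that multiplication by `f`
is a bijection of `𝓢'ₘ` exactly when `f` is invertible in `𝓞_M`.

The elements of `𝓞_M` are only given as smooth functions that preserve `𝓢ₘ` under multiplication.
The Schwartz space is complete and metrizable, hence Baire and barrelled, and the uniform
boundedness principle shows that `M_f` is continuous (`SchwartzMap.continuous_of_eq_mul`). Applying
this continuity to translates of a bump function, whose seminorms grow polynomially with the
translation, shows that `f` and its derivatives are bounded by polynomials
(`Function.HasTemperateGrowth.of_forall_mul_schwartz`). Conversely such functions belong to `𝓞_M`.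

If `f` is invertible, multiplication by `1/f` inverts multiplication by `f` on coefficients.

If `f e` is a basis, `f` has no zero `p`, since `δ_p` would be a nonzero coefficient with zero
superposition. Moreover every absolutely convergent sum `b` of point masses is of the form
`a ∘ M_f` with `a` a tempered distribution (`SFamily.LinIndep.exists_comp_mulCLM_eq_tsum`): the
superposition of `e` with coefficient `b` is also a superposition of `f e`. For a suitable `b`, with
masses at minimum points of `|f|` on growing balls, the polynomial growth of `a` along translated
bump functions becomes a polynomial bound for `1/f` (`exists_norm_inv_le_of_dvd_sum_delta`). By
`Function.HasTemperateGrowth.inv_of_norm_le` the derivatives of `1/f` are then polynomially bounded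
too, so `1/f` belongs to `𝓞_M`.
-/

open Filter Topology

/-! ### Completeness of the Schwartz space and the Banach–Steinhaus theorem -/

section Complete

variable {E F : Type*} [NormedAddCommGroup E] [NormedSpace ℝ E]
  [NormedAddCommGroup F] [NormedSpace ℝ F]

/-- The derivatives of order `l` of a Cauchy sequence of Schwartz functions converge uniformly. -/
theorem SchwartzMap.exists_tendstoUniformly_iteratedFDeriv [CompleteSpace F] {u : ℕ → 𝓢(E, F)}
    (hu : ∀ k l : ℕ, ∀ ε > 0, ∃ N, ∀ i ≥ N, ∀ j ≥ N, SchwartzMap.seminorm ℝ k l (u i - u j) < ε)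
    (l : ℕ) :
    ∃ g : E → E [×l]→L[ℝ] F, TendstoUniformly (fun i x => iteratedFDeriv ℝ l (u i) x) g atTop := by
  have hC : UniformCauchySeqOn (fun i x => iteratedFDeriv ℝ l (u i) x) atTop Set.univ := by
    rw [Metric.uniformCauchySeqOn_iff]
    intro ε hε
    obtain ⟨N, hN⟩ := hu 0 l ε hε
    refine ⟨N, fun i hi j hj x _ => lt_of_le_of_lt ?_ (hN i hi j hj)⟩
    have h := SchwartzMap.norm_iteratedFDeriv_le_seminorm ℝ (u i - u j) l x
    rwa [FunLike.coe_sub, iteratedFDeriv_sub_apply ((u i).smooth l).contDiffAt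
      ((u j).smooth l).contDiffAt, ← dist_eq_norm] at h
  have hlim : ∀ x, ∃ y, Tendsto (fun i => iteratedFDeriv ℝ l (u i) x) atTop (𝓝 y) := fun x =>
    cauchySeq_tendsto_of_complete (hC.cauchySeq (Set.mem_univ x))
  choose g hg using hlim
  exact ⟨g, tendstoUniformlyOn_univ.1 (hC.tendstoUniformlyOn_of_tendsto fun x _ => hg x)⟩

/-- A sequence of Schwartz functions that is Cauchy for every seminorm converges for every
seminorm. -/
theorem SchwartzMap.exists_limit_of_cauchy [CompleteSpace F] {u : ℕ → 𝓢(E, F)}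
    (hu : ∀ k l : ℕ, ∀ ε > 0, ∃ N, ∀ i ≥ N, ∀ j ≥ N, SchwartzMap.seminorm ℝ k l (u i - u j) < ε) :
    ∃ v : 𝓢(E, F), ∀ k l : ℕ, ∀ ε > 0, ∃ N, ∀ i ≥ N, SchwartzMap.seminorm ℝ k l (u i - v) < ε := by
  choose g hg using SchwartzMap.exists_tendstoUniformly_iteratedFDeriv hu
  -- The uniform limits of the derivatives form a Taylor series of the limit function.
  have hser : HasFTaylorSeriesUpTo ∞ (fun x => (g 0 x).curry0) (fun x l => g l x) := by
    have hd : ∀ l x, HasFDerivAt (fun y => g l y) (g (l + 1) x).curryLeft x := by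
      intro l x
      refine hasFDerivAt_of_tendstoUniformly (l := atTop)
        (f := fun i y => iteratedFDeriv ℝ l (u i) y)
        (f' := fun i y => (iteratedFDeriv ℝ (l + 1) (u i) y).curryLeft)
        (g' := fun y => (g (l + 1) y).curryLeft) ?_ ?_ (fun y => (hg l).tendsto_at y) x
      · exact (continuousMultilinearCurryLeftEquiv ℝ (fun _ : Fin (l + 1) => E)
          F).isometry.uniformContinuous.comp_tendstoUniformly (hg (l + 1))
      · intro i y
        exact (((u i).smooth ⊤).ftaylorSeries).fderiv l (by exact_mod_cast WithTop.coe_lt_top l) y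
    refine ⟨fun x => rfl, fun l _ x => hd l x, fun l _ => ?_⟩
    exact continuous_iff_continuousAt.2 fun x => (hd l x).continuousAt
  have hsm : ContDiff ℝ ∞ (fun x => (g 0 x).curry0) := hser.contDiff
  have hit : ∀ l x, iteratedFDeriv ℝ l (fun x => (g 0 x).curry0) x = g l x := fun l x =>
    (hser.eq_iteratedFDeriv (by exact_mod_cast le_top) x).symm
  -- Passing to the limit in `j` in the Cauchy condition.
  have hbd : ∀ k l : ℕ, ∀ ε > 0, ∃ N, ∀ i ≥ N, ∀ x,
      ‖x‖ ^ k * ‖iteratedFDeriv ℝ l (u i) x - g l x‖ ≤ ε := by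
    intro k l ε hε
    obtain ⟨N, hN⟩ := hu k l ε hε
    refine ⟨N, fun i hi x => ?_⟩
    refine le_of_tendsto (f := fun j => ‖x‖ ^ k * ‖iteratedFDeriv ℝ l (u i) x -
      iteratedFDeriv ℝ l (u j) x‖) (x := atTop) ?_ ?_
    · exact ((tendsto_const_nhds.sub ((hg l).tendsto_at x)).norm).const_mul _
    · filter_upwards [eventually_ge_atTop N] with j hj
      have h := (SchwartzMap.le_seminorm ℝ k l (u i - u j) x).trans (hN i hi j hj).le
      rwa [FunLike.coe_sub, iteratedFDeriv_sub_apply ((u i).smooth l).contDiffAt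
        ((u j).smooth l).contDiffAt] at h
  let v : 𝓢(E, F) :=
    { toFun := fun x => (g 0 x).curry0
      smooth' := hsm
      decay' := by
        intro k l
        obtain ⟨N, hN⟩ := hbd k l 1 one_pos
        refine ⟨SchwartzMap.seminorm ℝ k l (u N) + 1, fun x => ?_⟩
        rw [hit]
        calc ‖x‖ ^ k * ‖g l x‖
            ≤ ‖x‖ ^ k * (‖iteratedFDeriv ℝ l (u N) x‖ + ‖iteratedFDeriv ℝ l (u N) x - g l x‖) := by
              gcongr
              exact norm_le_norm_add_norm_sub _ _
          _ ≤ _ := by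
              rw [mul_add]
              exact add_le_add (SchwartzMap.le_seminorm ℝ k l (u N) x) (hN N le_rfl x) }
  refine ⟨v, fun k l ε hε => ?_⟩
  obtain ⟨N, hN⟩ := hbd k l (ε / 2) (half_pos hε)
  refine ⟨N, fun i hi => lt_of_le_of_lt ?_ (half_lt_self hε)⟩
  refine SchwartzMap.seminorm_le_bound ℝ k l _ (half_pos hε).le fun x => ?_
  have h := hN i hi x
  rwa [FunLike.coe_sub, iteratedFDeriv_sub_apply ((u i).smooth l).contDiffAt
    (v.smooth l).contDiffAt, show iteratedFDeriv ℝ l v x = g l x from hit l x]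

instance SchwartzMap.instCompleteSpace [CompleteSpace F] : CompleteSpace 𝓢(E, F) := by
  have : (uniformity 𝓢(E, F)).IsCountablyGenerated :=
    IsUniformAddGroup.uniformity_countably_generated
  refine UniformSpace.complete_of_cauchySeq_tendsto fun u hu => ?_
  have hW := schwartz_withSeminorms ℝ E F
  obtain ⟨v, hv⟩ := SchwartzMap.exists_limit_of_cauchy (u := u) fun k l ε hε => by
    have h0 : {x : 𝓢(E, F) | SchwartzMap.seminorm ℝ k l x < ε} ∈ 𝓝 (0 : 𝓢(E, F)) := by
      have hc : Continuous (SchwartzMap.seminorm ℝ k l : 𝓢(E, F) → ℝ) :=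
        hW.continuous_seminorm (k, l)
      exact (isOpen_lt hc continuous_const).mem_nhds (by simpa using hε)
    have h1 : {x : 𝓢(E, F) × 𝓢(E, F) |
        x.1 - x.2 ∈ {x : 𝓢(E, F) | SchwartzMap.seminorm ℝ k l x < ε}} ∈ uniformity 𝓢(E, F) := by
      rw [uniformity_eq_comap_nhds_zero_swapped]
      exact preimage_mem_comap h0
    obtain ⟨N, hN⟩ := cauchySeq_iff.1 hu _ h1
    exact ⟨N, fun i hi j hj => hN i hi j hj⟩
  exact ⟨v, (hW.tendsto_nhds u v).2 fun ⟨k, l⟩ ε hε => by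
    obtain ⟨N, hN⟩ := hv k l ε hε
    exact eventually_atTop.2 ⟨N, fun i hi => hN i hi⟩⟩

instance SchwartzMap.instBaireSpace [CompleteSpace F] : BaireSpace 𝓢(E, F) := by
  have : (uniformity 𝓢(E, F)).IsCountablyGenerated :=
    IsUniformAddGroup.uniformity_countably_generated
  infer_instance

end Complete

/-- A pointwise convergent series of continuous functionals on a barrelled space sums to a
continuous functional, by the Banach–Steinhaus theorem. -/
theorem exists_continuousLinearMap_tsum {𝕜 V : Type*} [NontriviallyNormedField 𝕜] [AddCommGroup V]
    [Module 𝕜 V] [TopologicalSpace V] [IsTopologicalAddGroup V] [ContinuousSMul 𝕜 V]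
    [BarrelledSpace 𝕜 V] (T : ℕ → V →L[𝕜] 𝕜) (hT : ∀ x, Summable fun j => T j x) :
    ∃ S : V →L[𝕜] 𝕜, ∀ x, S x = ∑' j, T j x := by
  let : UniformSpace V := IsTopologicalAddGroup.rightUniformSpace V
  have : IsUniformAddGroup V := isUniformAddGroup_of_addCommGroup
  refine ⟨continuousLinearMapOfTendsto (α := ℕ) (l := atTop) (fun N => ∑ j ∈ Finset.range N, T j)
    (f := fun x => ∑' j, T j x) ?_, fun x => rfl⟩
  rw [tendsto_pi_nhds]
  intro x
  simpa using (hT x).hasSum.tendsto_sum_nat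

/-! ### Multipliers of the Schwartz space -/

section Multiplier

variable {𝕜 : Type*} [RCLike 𝕜] {E : Type*} [NormedAddCommGroup E] [NormedSpace ℝ E]

/-- Evaluation of the `l`-th derivative of a Schwartz function at a point, as a linear map. -/
noncomputable def SchwartzMap.iteratedFDerivAt (l : ℕ) (x : E) :
    𝓢(E, 𝕜) →ₗ[𝕜] E [×l]→L[ℝ] 𝕜 where
  toFun φ := iteratedFDeriv ℝ l φ x
  map_add' φ χ := by
    rw [FunLike.coe_add]
    exact iteratedFDeriv_add_apply (φ.smooth l).contDiffAt (χ.smooth l).contDiffAt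
  map_smul' c φ := by
    rw [FunLike.coe_smul]
    exact iteratedFDeriv_const_smul_apply (φ.smooth l).contDiffAt

/-- The seminorms of the translates of a Schwartz function grow at most polynomially with the
translation. -/
theorem SchwartzMap.exists_seminorm_compSubConstCLM_le {q : Seminorm 𝕜 𝓢(E, 𝕜)}
    (hq : Continuous q) (χ : 𝓢(E, 𝕜)) :
    ∃ (k : ℕ) (C : ℝ), 0 ≤ C ∧ ∀ p : E, q (χ.compSubConstCLM 𝕜 p) ≤ C * (1 + ‖p‖) ^ k := by
  obtain ⟨s, C, -, hC⟩ := Seminorm.bound_of_continuous (schwartz_withSeminorms 𝕜 E 𝕜) q hq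
  set m : ℕ × ℕ := (s.sup Prod.fst, s.sup Prod.snd)
  set B : ℝ := 2 ^ m.1 * (Finset.Iic m).sup (fun m => SchwartzMap.seminorm 𝕜 m.1 m.2) χ
  have hB0 : 0 ≤ B := by positivity
  refine ⟨m.1, C * B, by positivity, fun p => ?_⟩
  refine (hC _).trans ?_
  rw [smul_apply, NNReal.smul_def, smul_eq_mul, mul_assoc]
  refine mul_le_mul_of_nonneg_left ?_ C.2
  refine Seminorm.finset_sup_apply_le (by positivity) fun ⟨k, l⟩ hkl => ?_
  have hk : k ≤ m.1 := Finset.le_sup (f := Prod.fst) hkl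
  have hl : l ≤ m.2 := Finset.le_sup (f := Prod.snd) hkl
  refine SchwartzMap.seminorm_le_bound 𝕜 k l _ (by positivity) fun x => ?_
  have hD : iteratedFDeriv ℝ l (χ.compSubConstCLM 𝕜 p) x = iteratedFDeriv ℝ l χ (x - p) :=
    iteratedFDeriv_comp_sub (f := χ) l p x
  have hx : ‖x‖ ≤ (1 + ‖p‖) * (1 + ‖x - p‖) := by
    have := norm_add_le (x - p) p
    rw [sub_add_cancel] at this
    nlinarith [norm_nonneg p, norm_nonneg (x - p)]
  calc ‖x‖ ^ k * ‖iteratedFDeriv ℝ l (χ.compSubConstCLM 𝕜 p) x‖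
      ≤ ((1 + ‖p‖) * (1 + ‖x - p‖)) ^ k * ‖iteratedFDeriv ℝ l χ (x - p)‖ := by
        rw [hD]; gcongr
    _ = (1 + ‖p‖) ^ k * ((1 + ‖x - p‖) ^ k * ‖iteratedFDeriv ℝ l χ (x - p)‖) := by
        rw [mul_pow, mul_assoc]
    _ ≤ (1 + ‖p‖) ^ m.1 * B := by
        gcongr
        · linarith [norm_nonneg p]
        · exact SchwartzMap.one_add_le_sup_seminorm_apply (𝕜 := 𝕜) hk hl χ (x - p)
    _ = B * (1 + ‖p‖) ^ m.1 := mul_comm _ _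

variable [FiniteDimensional ℝ E]

/-- A nonnegative compactly supported smooth function that equals `1` near the origin, as a
`𝕜`-valued test function. -/
theorem SchwartzMap.exists_bump (𝕜 : Type*) [RCLike 𝕜] (E : Type*) [NormedAddCommGroup E]
    [NormedSpace ℝ E] [FiniteDimensional ℝ E] :
    ∃ (χ : 𝓢(E, 𝕜)) (r : E → ℝ), (∀ x, χ x = (r x : 𝕜)) ∧ (∀ x, 0 ≤ r x) ∧ HasCompactSupport χ ∧
      (χ : E → 𝕜) =ᶠ[𝓝 0] fun _ => 1 := by
  let b : ContDiffBump (0 : E) := ⟨1, 2, one_pos, one_lt_two⟩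
  have h1 : HasCompactSupport (fun x : E => (b x : 𝕜)) :=
    b.hasCompactSupport.comp_left (g := ((↑) : ℝ → 𝕜)) RCLike.ofReal_zero
  have h2 : ContDiff ℝ ∞ (fun x : E => (b x : 𝕜)) :=
    (RCLike.ofRealCLM (K := 𝕜)).contDiff.comp b.contDiff
  refine ⟨h1.toSchwartzMap h2, b, fun x => rfl, fun x => b.nonneg, h1, ?_⟩
  filter_upwards [b.eventuallyEq_one] with x hx
  simp [hx]

/-- Multiplication by a smooth function is continuous on the Schwartz space as soon as it preserves
it. At a fixed point `x`, the derivatives of `f * φ` only depend on `φ` through multiplication by a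
compactly supported smooth function, so that they are continuous in `φ`; the seminorms of `f * φ`
are suprema of such expressions, and the Schwartz space is barrelled. -/
theorem SchwartzMap.continuous_of_eq_mul {f : E → 𝕜} (hf : ContDiff ℝ ∞ f)
    (M : 𝓢(E, 𝕜) →ₗ[𝕜] 𝓢(E, 𝕜)) (hM : ∀ φ x, M φ x = f x * φ x) : Continuous M := by
  have hW := schwartz_withSeminorms 𝕜 E 𝕜
  refine WithSeminorms.continuous_of_continuous_comp hW M ?_
  rintro ⟨k, l⟩
  let p : E → Seminorm 𝕜 𝓢(E, 𝕜) := fun x =>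
    ‖x‖₊ ^ k •
      (normSeminorm 𝕜 (E [×l]→L[ℝ] 𝕜)).comp (SchwartzMap.iteratedFDerivAt l x ∘ₗ M)
  have hp_apply : ∀ x φ, p x φ = ‖x‖ ^ k * ‖iteratedFDeriv ℝ l (M φ) x‖ := fun x φ => rfl
  have hp : ∀ x, Continuous (p x) := by
    intro x
    obtain ⟨χ, -, -, -, hχc, hχ1⟩ := SchwartzMap.exists_bump 𝕜 E
    -- Near `x`, multiplication by `f` agrees with multiplication by this cut-off of `f`.
    have hg : (fun y => χ (y - x) * f y).HasTemperateGrowth := by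
      refine HasCompactSupport.hasTemperateGrowth ?_ ?_
      · exact (hχc.comp_homeomorph (Homeomorph.subRight x)).mul_right
      · exact ((χ.smooth ⊤).comp (contDiff_id.sub contDiff_const)).mul hf
    refine Seminorm.continuous_of_le (q := ((SchwartzMap.seminorm 𝕜 k l).comp
      (SchwartzMap.smulLeftCLM 𝕜 (fun y => χ (y - x) * f y)).toLinearMap)) ?_ ?_
    · exact (hW.continuous_seminorm (k, l)).comp
        (SchwartzMap.smulLeftCLM 𝕜 (fun y => χ (y - x) * f y)).continuous
    · intro φ
      rw [hp_apply, Seminorm.comp_apply]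
      have hev : (M φ : E → 𝕜) =ᶠ[𝓝 x]
          (SchwartzMap.smulLeftCLM 𝕜 (fun y => χ (y - x) * f y) φ) := by
        have ht : Tendsto (fun y => y - x) (𝓝 x) (𝓝 0) :=
          tendsto_sub_nhds_zero_iff.2 tendsto_id
        filter_upwards [ht.eventually hχ1] with y hy
        rw [SchwartzMap.smulLeftCLM_apply_apply hg, hM, hy, one_mul, smul_eq_mul]
      rw [(hev.iteratedFDeriv ℝ l).eq_of_nhds]
      exact SchwartzMap.le_seminorm 𝕜 k l _ x
  have hbdd : BddAbove (Set.range p) := by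
    rw [Seminorm.bddAbove_range_iff]
    intro φ
    refine ⟨SchwartzMap.seminorm 𝕜 k l (M φ), ?_⟩
    rintro _ ⟨x, rfl⟩
    exact SchwartzMap.le_seminorm 𝕜 k l (M φ) x
  have hsup : Continuous (⨆ x, p x : Seminorm 𝕜 𝓢(E, 𝕜)) := by
    rw [Seminorm.coe_iSup_eq hbdd]
    exact Seminorm.continuous_iSup p hp hbdd
  refine Seminorm.continuous_of_le hsup fun φ => ?_
  refine SchwartzMap.seminorm_le_bound 𝕜 k l _ (apply_nonneg _ _) fun x => ?_
  rw [Seminorm.iSup_apply hbdd]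
  exact le_ciSup (f := fun x => p x φ) (Seminorm.bddAbove_range_iff.1 hbdd φ) x

/-- A smooth function that preserves the Schwartz space by multiplication is of temperate growth:
its derivatives at `p` are those of its product with the translate to `p` of a fixed bump
function, and multiplication is continuous. -/
theorem Function.HasTemperateGrowth.of_forall_mul_schwartz {f : E → 𝕜} (hf : ContDiff ℝ ∞ f)
    (h : ∀ φ : 𝓢(E, 𝕜), ∃ ψ : 𝓢(E, 𝕜), ∀ x, ψ x = f x * φ x) : f.HasTemperateGrowth := by
  choose m hm using h
  let M : 𝓢(E, 𝕜) →ₗ[𝕜] 𝓢(E, 𝕜) :=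
    { toFun := m
      map_add' := fun φ χ => by ext x; simp [hm, mul_add]
      map_smul' := fun c φ => by ext x; simp [hm, mul_left_comm] }
  have hMc : Continuous M := SchwartzMap.continuous_of_eq_mul hf M hm
  obtain ⟨χ, -, -, -, -, hχ1⟩ := SchwartzMap.exists_bump 𝕜 E
  refine ⟨hf, fun l => ?_⟩
  have hq : Continuous ((SchwartzMap.seminorm 𝕜 0 l).comp M) :=
    ((schwartz_withSeminorms 𝕜 E 𝕜).continuous_seminorm (0, l)).comp hMc
  obtain ⟨k, C, -, hC⟩ := SchwartzMap.exists_seminorm_compSubConstCLM_le hq χ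
  refine ⟨k, C, fun p => le_trans ?_ (hC p)⟩
  have hev : (M (χ.compSubConstCLM 𝕜 p) : E → 𝕜) =ᶠ[𝓝 p] f := by
    have ht : Tendsto (fun y => y - p) (𝓝 p) (𝓝 0) :=
      tendsto_sub_nhds_zero_iff.2 tendsto_id
    filter_upwards [ht.eventually hχ1] with y hy
    rw [show M (χ.compSubConstCLM 𝕜 p) y = f y * _ from hm _ y,
      SchwartzMap.compSubConstCLM_apply, hy, mul_one]
  rw [← (hev.iteratedFDeriv ℝ l).eq_of_nhds]
  exact SchwartzMap.norm_iteratedFDeriv_le_seminorm 𝕜 _ l p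

end Multiplier

/-! ### Inverses of functions of temperate growth -/

section Inverse

variable {𝕜 : Type*} [RCLike 𝕜] {E : Type*} [NormedAddCommGroup E] [NormedSpace ℝ E]

/-- Polynomial bounds on the derivatives up to a fixed order are stable under products. -/
theorem exists_norm_iteratedFDeriv_smul_le {G : Type*} [NormedAddCommGroup G] [NormedSpace ℝ G]
    [NormedSpace 𝕜 G] [IsScalarTower ℝ 𝕜 G] {f : E → 𝕜} {g : E → G} {n : ℕ}
    (hf : ContDiff ℝ ∞ f) (hg : ContDiff ℝ ∞ g)
    (hfb : ∃ (k : ℕ) (C : ℝ), 0 ≤ C ∧ ∀ i ≤ n, ∀ x, ‖iteratedFDeriv ℝ i f x‖ ≤ C * (1 + ‖x‖) ^ k)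
    (hgb : ∃ (k : ℕ) (C : ℝ), 0 ≤ C ∧ ∀ i ≤ n, ∀ x, ‖iteratedFDeriv ℝ i g x‖ ≤ C * (1 + ‖x‖) ^ k) :
    ∃ (k : ℕ) (C : ℝ), 0 ≤ C ∧
      ∀ i ≤ n, ∀ x, ‖iteratedFDeriv ℝ i (fun y => f y • g y) x‖ ≤ C * (1 + ‖x‖) ^ k := by
  obtain ⟨k, C, hC, hfb⟩ := hfb
  obtain ⟨k', C', hC', hgb⟩ := hgb
  refine ⟨k + k', 2 ^ n * (C * C'), by positivity, fun i hi x => ?_⟩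
  calc ‖iteratedFDeriv ℝ i (fun y => f y • g y) x‖
      ≤ ∑ j ∈ Finset.range (i + 1),
          (i.choose j : ℝ) * ‖iteratedFDeriv ℝ j f x‖ * ‖iteratedFDeriv ℝ (i - j) g x‖ :=
        norm_iteratedFDeriv_smul_le hf hg x (by exact_mod_cast le_top)
    _ ≤ ∑ j ∈ Finset.range (i + 1),
          (i.choose j : ℝ) * (C * (1 + ‖x‖) ^ k) * (C' * (1 + ‖x‖) ^ k') := by
        refine Finset.sum_le_sum fun j hj => ?_
        gcongr
        · exact hfb j (by grind) x
        · exact hgb (i - j) (by omega) x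
    _ = 2 ^ i * (C * C' * (1 + ‖x‖) ^ (k + k')) := by
        rw [← Finset.sum_mul, ← Finset.sum_mul, ← Nat.cast_sum, Nat.sum_range_choose]
        push_cast
        ring
    _ ≤ 2 ^ n * (C * C') * (1 + ‖x‖) ^ (k + k') := by
        rw [mul_assoc _ (C * C')]
        gcongr
        exact one_le_two

/-- The inverse of a nowhere vanishing function of temperate growth is of temperate growth as soon
as it is bounded by a polynomial, because its derivatives are controlled inductively through
`D(1/f) = -(1/f)² Df`. -/
theorem Function.HasTemperateGrowth.inv_of_norm_le {f : E → 𝕜} (hf : f.HasTemperateGrowth)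
    (h0 : ∀ x, f x ≠ 0) {k : ℕ} {C : ℝ} (hC : ∀ x, ‖(f x)⁻¹‖ ≤ C * (1 + ‖x‖) ^ k) :
    (fun x => (f x)⁻¹).HasTemperateGrowth := by
  set g : E → 𝕜 := fun x => (f x)⁻¹
  have hg : ContDiff ℝ ∞ g := hf.1.inv h0
  have hC0 : 0 ≤ C := by simpa using (norm_nonneg _).trans (hC 0)
  have hf' : ContDiff ℝ ∞ (fderiv ℝ f) := hf.1.fderiv_right (by simp)
  have hfn : ContDiff ℝ ∞ (fun y => -fderiv ℝ f y) := hf'.neg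
  have hgfn : ContDiff ℝ ∞ (fun y => g y • -fderiv ℝ f y) := hg.smul hfn
  have hfd : fderiv ℝ g = fun x => g x • (g x • -fderiv ℝ f x) := by
    funext x
    have h := (hasFDerivAt_inv' (𝕜 := ℝ) (h0 x)).comp x
      (hf.1.differentiable (by simp)).differentiableAt.hasFDerivAt
    rw [show g = Inv.inv ∘ f from rfl, h.fderiv]
    ext v
    simp
    ring
  have key : ∀ n : ℕ, ∃ (k : ℕ) (C : ℝ), 0 ≤ C ∧
      ∀ i ≤ n, ∀ x, ‖iteratedFDeriv ℝ i g x‖ ≤ C * (1 + ‖x‖) ^ k := by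
    intro n
    induction n with
    | zero =>
      refine ⟨k, C, hC0, fun i hi x => ?_⟩
      obtain rfl : i = 0 := by omega
      rw [norm_iteratedFDeriv_zero]
      exact hC x
    | succ n ih =>
      have hfb : ∃ (k : ℕ) (C : ℝ), 0 ≤ C ∧ ∀ i ≤ n, ∀ x,
          ‖iteratedFDeriv ℝ i (fun y => -fderiv ℝ f y) x‖ ≤ C * (1 + ‖x‖) ^ k := by
        obtain ⟨k, C, hC, h⟩ := hf.norm_iteratedFDeriv_le_uniform (n + 1)
        refine ⟨k, C, hC, fun i hi x => ?_⟩
        have hneg := iteratedFDeriv_neg_apply (𝕜 := ℝ) (i := i) (f := fderiv ℝ f) (x := x)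
        rw [show (fun y => -fderiv ℝ f y) = -fderiv ℝ f from rfl, hneg, norm_neg,
          norm_iteratedFDeriv_fderiv]
        exact h (i + 1) (by omega) x
      have hb := exists_norm_iteratedFDeriv_smul_le hg hfn ih hfb
      obtain ⟨k₁, C₁, hC₁, h₁⟩ := exists_norm_iteratedFDeriv_smul_le hg hgfn ih hb
      refine ⟨k + k₁, C + C₁, by positivity, fun i hi x => ?_⟩
      have hx : 1 ≤ 1 + ‖x‖ := by linarith [norm_nonneg x]
      rcases i with _ | i
      · rw [norm_iteratedFDeriv_zero]
        exact (hC x).trans (mul_le_mul (by linarith) (pow_le_pow_right₀ hx (by omega))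
          (by positivity) (by positivity))
      · rw [← norm_iteratedFDeriv_fderiv, hfd]
        exact (h₁ i (by omega) x).trans (mul_le_mul (by linarith)
          (pow_le_pow_right₀ hx (by omega)) (by positivity) (by positivity))
  refine ⟨hg, fun n => ?_⟩
  obtain ⟨k, C, -, h⟩ := key n
  exact ⟨k, C, h n le_rfl⟩

/-- If every absolutely convergent combination of point masses is divisible by `f` in the space of
tempered distributions, then `1/f` is bounded by a polynomial. The combination used has a mass of
size `(j + 1)⁻²` at a point `P j` where `|f|` is minimal on the closed ball of radius `j`, with
the phase of `f (P j)`, so that all the terms of its quotient by `f` are nonnegative; testing the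
quotient against a bump function around `P j` then bounds `1/|f (P j)|`. -/
theorem exists_norm_inv_le_of_dvd_sum_delta [FiniteDimensional ℝ E] {f : E → 𝕜}
    (hf : f.HasTemperateGrowth) (h0 : ∀ x, f x ≠ 0)
    (H : ∀ (c : ℕ → 𝕜) (P : ℕ → E), Summable (fun j => ‖c j‖) → ∃ a : 𝓢(E, 𝕜) →L[𝕜] 𝕜,
      ∀ φ : 𝓢(E, 𝕜), a (SchwartzMap.smulLeftCLM 𝕜 f φ) = ∑' j, c j * φ (P j)) :
    ∃ (k : ℕ) (C : ℝ), ∀ x, ‖(f x)⁻¹‖ ≤ C * (1 + ‖x‖) ^ k := by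
  have hmin : ∀ j : ℕ, ∃ p : E, ‖p‖ ≤ j ∧ ∀ x, ‖x‖ ≤ j → ‖f p‖ ≤ ‖f x‖ := by
    intro j
    obtain ⟨p, hp, h⟩ := (isCompact_closedBall (0 : E) (j : ℝ)).exists_isMinOn
      ⟨0, by simp⟩ hf.1.continuous.norm.continuousOn
    exact ⟨p, by simpa using hp, fun x hx => h (by simpa using hx)⟩
  choose P hP hPmin using hmin
  set w : ℕ → ℝ := fun j => (((j : ℝ) + 1) ^ 2)⁻¹ with hw
  have hw0 : ∀ j, 0 < w j := fun j => by positivity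
  have hws : Summable w := by
    have h := (summable_nat_add_iff 1).2 (Real.summable_nat_pow_inv.2 one_lt_two)
    simpa [hw] using h
  have hfn : ∀ x, 0 < ‖f x‖ := fun x => norm_pos_iff.2 (h0 x)
  set c : ℕ → 𝕜 := fun j => (w j : 𝕜) * (f (P j) * ((‖f (P j)‖⁻¹ : ℝ) : 𝕜)) with hc
  have hcn : ∀ j, ‖c j‖ = w j := by
    intro j
    rw [hc]
    simp only [norm_mul, RCLike.norm_ofReal, abs_of_pos (hw0 j), abs_inv, abs_norm]
    rw [mul_inv_cancel₀ (hfn _).ne', mul_one]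
  obtain ⟨a, ha⟩ := H c P (by simpa only [hcn] using hws)
  obtain ⟨χ, r, hχr, hr0, hχc, hχ1⟩ := SchwartzMap.exists_bump 𝕜 E
  have hq : Continuous ((normSeminorm 𝕜 𝕜).comp a.toLinearMap) := a.continuous.norm
  obtain ⟨k, C, hC0, hC⟩ := SchwartzMap.exists_seminorm_compSubConstCLM_le hq χ
  have hmain : ∀ j, ‖f (P j)‖⁻¹ ≤ ((j : ℝ) + 1) ^ 2 * (C * (1 + ‖P j‖) ^ k) := by
    intro j
    have h1 : HasCompactSupport fun x => χ (x - P j) * (f x)⁻¹ :=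
      (hχc.comp_homeomorph (Homeomorph.subRight (P j))).mul_right
    have h2 : ContDiff ℝ ∞ fun x => χ (x - P j) * (f x)⁻¹ :=
      ((χ.smooth ⊤).comp (contDiff_id.sub contDiff_const)).mul (hf.1.inv h0)
    -- `f` vanishes nowhere, so the translated bump is `f` times a test function.
    have hθ : SchwartzMap.smulLeftCLM 𝕜 f (h1.toSchwartzMap h2) = χ.compSubConstCLM 𝕜 (P j) := by
      ext x
      rw [SchwartzMap.smulLeftCLM_apply_apply hf, SchwartzMap.compSubConstCLM_apply, smul_eq_mul]
      change f x * (χ (x - P j) * (f x)⁻¹) = _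
      rw [mul_left_comm, mul_inv_cancel₀ (h0 x), mul_one]
    set t : ℕ → ℝ := fun i => w i * (r (P i - P j) * ‖f (P i)‖⁻¹) with ht
    have ht0 : ∀ i, 0 ≤ t i := fun i =>
      mul_nonneg (hw0 i).le (mul_nonneg (hr0 _) (inv_nonneg.2 (norm_nonneg _)))
    have hterm : ∀ i, c i * h1.toSchwartzMap h2 (P i) = (t i : 𝕜) := by
      intro i
      change (w i : 𝕜) * (f (P i) * ((‖f (P i)‖⁻¹ : ℝ) : 𝕜)) * (χ (P i - P j) * (f (P i))⁻¹) = _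
      rw [hχr, ht]
      have := h0 (P i)
      push_cast
      field_simp
    have hts : Summable t := by
      have hs : Summable fun i => ‖c i * h1.toSchwartzMap h2 (P i)‖ := by
        refine Summable.of_nonneg_of_le (fun _ => norm_nonneg _) (fun i => ?_)
          (hws.mul_right (SchwartzMap.seminorm 𝕜 0 0 (h1.toSchwartzMap h2)))
        rw [norm_mul, hcn]
        exact mul_le_mul_of_nonneg_left (SchwartzMap.norm_le_seminorm 𝕜 _ _) (hw0 i).le
      refine hs.congr fun i => ?_
      rw [hterm, RCLike.norm_ofReal, abs_of_nonneg (ht0 i)]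
    have hsum : a (χ.compSubConstCLM 𝕜 (P j)) = ((∑' i, t i : ℝ) : 𝕜) := by
      rw [← hθ, ha, RCLike.ofReal_tsum]
      exact tsum_congr hterm
    have hrj : r 0 = 1 := by
      have := hχ1.eq_of_nhds
      rw [hχr] at this
      exact_mod_cast this
    have hle : t j ≤ C * (1 + ‖P j‖) ^ k := by
      refine (hts.le_tsum j fun i _ => ht0 i).trans (le_trans ?_ (hC (P j)))
      change _ ≤ ‖a (χ.compSubConstCLM 𝕜 (P j))‖
      rw [hsum, RCLike.norm_ofReal]
      exact le_abs_self _
    rw [ht] at hle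
    simp only [sub_self, hrj, one_mul, hw] at hle
    rwa [inv_mul_le_iff₀ (by positivity)] at hle
  refine ⟨2 + k, 2 ^ (2 + k) * C, fun x => ?_⟩
  -- `P j` minimizes `|f|` on a ball that contains `x`.
  set j := ⌈‖x‖⌉₊
  have hxj : ‖x‖ ≤ j := Nat.le_ceil _
  have hj : (j : ℝ) + 1 ≤ 2 * (1 + ‖x‖) := by
    linarith [Nat.ceil_lt_add_one (norm_nonneg x), norm_nonneg x]
  calc ‖(f x)⁻¹‖ = ‖f x‖⁻¹ := norm_inv _
    _ ≤ ‖f (P j)‖⁻¹ := inv_anti₀ (hfn _) (hPmin j x hxj)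
    _ ≤ ((j : ℝ) + 1) ^ 2 * (C * (1 + ‖P j‖) ^ k) := hmain j
    _ ≤ (2 * (1 + ‖x‖)) ^ 2 * (C * (2 * (1 + ‖x‖)) ^ k) := by
        gcongr
        linarith [hP j]
    _ = 2 ^ (2 + k) * C * (1 + ‖x‖) ^ (2 + k) := by
        rw [mul_pow, mul_pow, pow_add, pow_add]
        ring

end Inverse

/-! ### Products of families by multipliers -/

theorem OM.hasTemperateGrowth {𝕜 : Type*} [RCLike 𝕜] {m : ℕ} (f : OM 𝕜 m) :
    (f : Rn m → 𝕜).HasTemperateGrowth :=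
  .of_forall_mul_schwartz f.2.1 f.2.2

theorem OM.mem_of_hasTemperateGrowth {𝕜 : Type*} [RCLike 𝕜] {m : ℕ} {f : Rn m → 𝕜}
    (hf : f.HasTemperateGrowth) : f ∈ OM 𝕜 m :=
  ⟨hf.1, fun φ => ⟨SchwartzMap.smulLeftCLM 𝕜 f φ, fun x => by
    rw [SchwartzMap.smulLeftCLM_apply_apply hf, smul_eq_mul]⟩⟩

/-- Multiplication of test functions by an element of `𝓞_M`, as a continuous linear map. -/
noncomputable def OM.mulCLM {𝕜 : Type*} [RCLike 𝕜] {m : ℕ} (f : OM 𝕜 m) :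
    TestFn 𝕜 m →L[𝕜] TestFn 𝕜 m :=
  SchwartzMap.smulLeftCLM 𝕜 (f : Rn m → 𝕜)

theorem OM.mulCLM_apply {𝕜 : Type*} [RCLike 𝕜] {m : ℕ} (f : OM 𝕜 m) (φ : TestFn 𝕜 m) (x : Rn m) :
    OM.mulCLM f φ x = (f : Rn m → 𝕜) x * φ x := by
  rw [OM.mulCLM, SchwartzMap.smulLeftCLM_apply_apply (OM.hasTemperateGrowth f), smul_eq_mul]

theorem OM.mulCLM_mulCLM_of_mul_eq_one {𝕜 : Type*} [RCLike 𝕜] {m : ℕ} {f g : OM 𝕜 m}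
    (h : f * g = 1) (φ : TestFn 𝕜 m) : OM.mulCLM f (OM.mulCLM g φ) = φ := by
  ext x
  have hx : (f : Rn m → 𝕜) x * (g : Rn m → 𝕜) x = 1 := congrFun (congrArg Subtype.val h) x
  rw [OM.mulCLM_apply, OM.mulCLM_apply, ← mul_assoc, hx, one_mul]

theorem OM.isUnit_of_hasTemperateGrowth_inv {𝕜 : Type*} [RCLike 𝕜] {m : ℕ} (f : OM 𝕜 m)
    (h0 : ∀ x, (f : Rn m → 𝕜) x ≠ 0)
    (hg : (fun x => ((f : Rn m → 𝕜) x)⁻¹).HasTemperateGrowth) : IsUnit f :=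
  IsUnit.of_mul_eq_one ⟨_, OM.mem_of_hasTemperateGrowth hg⟩
    (Subtype.ext (funext fun x => mul_inv_cancel₀ (h0 x)))

namespace SFamily

variable {𝕜 : Type*} [RCLike 𝕜] {m n : ℕ}

theorem hat_smul (f : OM 𝕜 m) (v : SFamily 𝕜 m n) (φ : TestFn 𝕜 n) :
    (f • v).hat φ = OM.mulCLM f (v.hat φ) := by
  ext p
  rw [hat_apply, OM.mulCLM_apply, hat_apply]
  rfl

/-- The superposition of `f v` is that of `v`, with the coefficients multiplied by `f`. -/
theorem superposition_smul (f : OM 𝕜 m) (v : SFamily 𝕜 m n) (a : TempDist 𝕜 m) :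
    (f • v).superposition a = v.superposition (a.comp (OM.mulCLM f)) :=
  LinearMap.ext fun φ => congrArg a (hat_smul f v φ)

theorem mem_span_iff {v : SFamily 𝕜 m n} {u : TempDist 𝕜 n} :
    u ∈ v.span ↔ ∃ a : TempDist 𝕜 m, ∀ φ, a (v.hat φ) = u φ :=
  ⟨fun ⟨a, h⟩ => ⟨a, fun φ => LinearMap.congr_fun h φ⟩, fun ⟨a, h⟩ => ⟨a, LinearMap.ext h⟩⟩

/-- A multiplier of an `𝓢`-linearly independent product vanishes nowhere: at a zero `p`, the
superposition with coefficient `δ_p` would be zero. -/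
theorem LinIndep.apply_ne_zero {f : OM 𝕜 m} {v : SFamily 𝕜 m n} (h : (f • v).LinIndep)
    (p : Rn m) : (f : Rn m → 𝕜) p ≠ 0 := by
  intro hp
  let δ : TempDist 𝕜 m := (BoundedContinuousFunction.evalCLM 𝕜 p).comp
    (SchwartzMap.toBoundedContinuousFunctionCLM 𝕜 (Rn m) 𝕜)
  have hδ : ∀ φ, δ φ = φ p := fun φ => rfl
  have h0 : δ = 0 := by
    refine h δ (LinearMap.ext fun φ => ?_)
    change δ ((f • v).hat φ) = 0
    rw [hδ, hat_smul, OM.mulCLM_apply, hp, zero_mul]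
  obtain ⟨χ, -, -, -, -, hχ⟩ := SchwartzMap.exists_bump 𝕜 (Rn m)
  have h1 : δ (χ.compSubConstCLM 𝕜 p) = 1 := by
    rw [hδ, SchwartzMap.compSubConstCLM_apply, sub_self, hχ.eq_of_nhds]
  rw [h0] at h1
  exact zero_ne_one h1

/-- If `v` is `𝓢`-linearly independent and `f v` spans everything, then every absolutely
convergent combination of point masses is divisible by `f`: the superposition of `v` with these
coefficients is a tempered distribution, hence a superposition of `f v`. -/
theorem LinIndep.exists_comp_mulCLM_eq_tsum {f : OM 𝕜 m} {v : SFamily 𝕜 m n} (hv : v.LinIndep)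
    (hfv : (f • v).span = ⊤) {c : ℕ → 𝕜} (P : ℕ → Rn m) (hc : Summable fun j => ‖c j‖) :
    ∃ a : TempDist 𝕜 m, ∀ φ, a (OM.mulCLM f φ) = ∑' j, c j * φ (P j) := by
  have hs : ∀ φ : TestFn 𝕜 m, Summable fun j => c j * φ (P j) := fun φ => by
    refine Summable.of_norm_bounded (hc.mul_right (SchwartzMap.seminorm 𝕜 0 0 φ)) fun j => ?_
    rw [norm_mul]
    exact mul_le_mul_of_nonneg_left (SchwartzMap.norm_le_seminorm 𝕜 φ _) (norm_nonneg _)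
  obtain ⟨b, hb⟩ := exists_continuousLinearMap_tsum (𝕜 := 𝕜) (V := TestFn 𝕜 m)
    (fun j => c j • (BoundedContinuousFunction.evalCLM 𝕜 (P j)).comp
      (SchwartzMap.toBoundedContinuousFunctionCLM 𝕜 (Rn m) 𝕜)) hs
  obtain ⟨u, hu⟩ := exists_continuousLinearMap_tsum (𝕜 := 𝕜) (V := TestFn 𝕜 n)
    (fun j => c j • v.dist (P j)) fun φ => by
      simpa only [hat_apply, smul_apply, smul_eq_mul] using hs (v.hat φ)
  have hbu : ∀ φ, b (v.hat φ) = u φ := fun φ => by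
    rw [hb, hu]
    exact tsum_congr fun j => congrArg (c j * ·) (hat_apply v φ (P j))
  obtain ⟨a, ha⟩ := mem_span_iff.1 (hfv ▸ Submodule.mem_top : u ∈ (f • v).span)
  -- `a ∘ M_f` and `b` give the same superposition of `v`.
  have hab : a.comp (OM.mulCLM f) - b = 0 := by
    refine hv _ (LinearMap.ext fun φ => ?_)
    change a (OM.mulCLM f (v.hat φ)) - b (v.hat φ) = 0
    rw [← hat_smul, ha, hbu, sub_self]
  refine ⟨a, fun φ => ?_⟩
  exact (DFunLike.congr_fun (sub_eq_zero.1 hab) φ).trans (hb φ)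

end SFamily

theorem mainTheorem5 {𝕜 : Type*} [RCLike 𝕜] (m n : ℕ) (e : SFamily 𝕜 m n) (he : e.IsBasis ⊤)
    (f : OM 𝕜 m) : (f • e).IsBasis ⊤ ↔ IsUnit f := by
  constructor
  · rintro ⟨hind, hspan⟩
    have h0 := hind.apply_ne_zero
    obtain ⟨k, C, hC⟩ := exists_norm_inv_le_of_dvd_sum_delta (OM.hasTemperateGrowth f) h0
      fun c P hc => SFamily.LinIndep.exists_comp_mulCLM_eq_tsum he.1 hspan P hc
    exact OM.isUnit_of_hasTemperateGrowth_inv f h0 ((OM.hasTemperateGrowth f).inv_of_norm_le h0 hC)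
  · intro hf
    obtain ⟨g, hfg⟩ := hf.exists_right_inv
    have hgf : g * f = 1 := by rw [mul_comm, hfg]
    refine ⟨fun a ha => ?_, eq_top_iff.2 fun u _ => ?_⟩
    · rw [SFamily.superposition_smul] at ha
      ext φ
      have h := DFunLike.congr_fun (he.1 _ ha) (OM.mulCLM g φ)
      change a (OM.mulCLM f (OM.mulCLM g φ)) = 0 at h
      rwa [OM.mulCLM_mulCLM_of_mul_eq_one hfg] at h
    · obtain ⟨a, ha⟩ := SFamily.mem_span_iff.1 (he.2 ▸ Submodule.mem_top : u ∈ e.span)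
      refine SFamily.mem_span_iff.2 ⟨a.comp (OM.mulCLM g), fun φ => ?_⟩
      rw [SFamily.hat_smul, ← ha]
      exact congrArg a (OM.mulCLM_mulCLM_of_mul_eq_one hgf _)
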